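/- **Setting.** A network is a finite connected graph $G$ whose nodes carry pairwise distinct identities; its topology never changes, and every node knows its own identity and those of its neighbours. A deterministic synchronous distributed algorithm $Alg$ runs on it: in each round every node sends a message to each neighbour, computed from its state, receives the neighbours' messages, and then computes its new state from its identity, the identities of its neighbours, its old state, its input of the round (arbitrary inputs may arrive in every round), and the received messages. A configuration is the collection of the nodes' states, and a legality predicate $f$ assigns a truth value to each network with a configuration. Let $F$ be a family of networks. Rounds are counted from an initial round $r_0$; values at round $r$ are those at the end of round $r$, and $f_r$ is the value of $f$ on the configuration of round $r$. A *reactive proof labeling scheme* (RPLS) consists of a specification of the initial labelings for a given configuration at $r_0$, a marker and a verifier; the marker and the verifier are local and are the same for all networks in $F$. In each round after $r_0$: each node $v$ sends its label $L(v)$ to its neighbours; the verifier at $v$ outputs $0$ or $1$ from $v$'s identity, its neighbours' identities, $v$'s state, $L(v)$ and the received labels; $Alg$ is executed; then the marker at $v$ computes the new $L(v)$ from the two kinds of identities, $v$'s new state and its input of the round, the old $L(v)$ and the received labels. A *fault just before round $r$* is an arbitrary change of at least one state or label between the end of round $r-1$ and the beginning of round $r$. An execution is *correct until $r$* (excluding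 $r$) if no fault occurs before the beginning of round $r$ and $f_k=1$ for all $r_0\le k<r$. The configuration *becomes incorrect in $r$* if there is no fault before round $r$ other than just before it, $f_k=1$ for all $r_0\le k<r$, faults occur just before $r$ and none later, and $f_r=0$ (for $r=r_0$ the initial states and labels are regarded as arbitrary values set by the environment). An RPLS is *correct* for $f$ and $Alg$ on $F$ if every legal initial configuration on a network in $F$ has a specified initial labeling, and for every network in $F$: 1. (completeness) if the labels at $r_0$ are as specified and the execution is correct until $r+1$ (excluding $r+1$), then in every round $k$ with $r_0<k\le r+1$ all verifiers output $1$; 2. (soundness) if the configuration becomes incorrect in $r$, then some verifier outputs $0$ in round $r+1$. *Pyramids.* Let $d$ be the diameter of $G$. For a history of $G$, the *pyramid* of a node $p$ at round $t$ is the sequence of partial snapshots $VI_p^t(0),\dots,VI_p^t(d)$, where $VI_p^t(l)$ records, for each node within $l$ hops from $p$, its neighbours' identities, its state at the end of round $t-l$ and its input of that round (or a mark that no round was executed, if round $t-l$ is at or before the start of the history; moments before the start are copies of the start). **Theorem.** Let $Alg$, $F$ and $f$ be arbitrary, subject only to the condition that inputs do not decide legality: for every configuration $c$ on a network in $F$ and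 every $k\ge 0$, if some sequence of inputs makes all configurations of the fault-free run from $c$ legal up to and including round $k$ of the run, then every sequence of inputs leads to a legal configuration after $k$ fault-free rounds from $c$. (This holds automatically if $Alg$ has no inputs, and also if every round of $Alg$ preserves $f$.) Then there is an RPLS, with pyramids as labels, such that: * it is correct for $f$ and $Alg$ on $F$; * its specified initial labelings of a configuration $c$ are exactly those that give each node its pyramid for some legal, possibly fictitious, execution of $Alg$ that ends in $c$ at round $r_0$ (all its configurations satisfy $f$; it may start at any earlier round or at $r_0$ itself); * if the labels at $r_0$ are the pyramids of such a legal past and the execution is correct until $r+1$, then at every round $t$ with $r_0\le t\le r$ the label of every node is its pyramid at round $t$ for that past continued by the actual execution. -/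

import Mathlib

/-- A network: a finite connected graph whose nodes are named by pairwise distinct identities.
A node is identified with its identity. -/
structure Network (ID : Type*) where
  nodes : Finset ID
  graph : SimpleGraph nodes
  connected : graph.Connected

namespace Network

/-- The set of identities of the neighbours of `p`, which `p` knows. -/
noncomputable def nbrs {ID : Type*} (N : Network ID) (p : N.nodes) : Finset ID :=
  open Classical in
  N.nodes.filter fun u => ∃ h : u ∈ N.nodes, N.graph.Adj p ⟨u, h⟩

/-- A message exchange: `p` receives `msg u` from each neighbour `u`, and nothing (`none`)
from any other identity. -/
noncomputable def received {ID β : Type*} (N : Network ID) (p : N.nodes)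
    (msg : N.nodes → β) : ID → Option β :=
  open Classical in
  fun u => if h : ∃ hu : u ∈ N.nodes, N.graph.Adj p ⟨u, hu⟩ then some (msg ⟨u, h.1⟩) else none

end Network

/-- A configuration: the algorithm state of each node. -/
abbrev Config {ID : Type*} (σ : Type*) (N : Network ID) := N.nodes → σ

/-- A legality predicate, defined on a network together with the states of its nodes. -/
abbrev LegalityPredicate (ID σ : Type*) := (N : Network ID) → Config σ N → Prop

/-- A deterministic synchronous distributed algorithm with states `σ`, per-round inputs `ι` from
the outside world and messages `μ`. A node knows its identity and its neighbours' identities.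
`send p nbrs s u` is the message that `p` in state `s` sends to its neighbour `u`;
`compute p nbrs s i m` is the new state, from the old state `s`, the input `i` of the
round and the received messages `m`. -/
structure Algorithm (ID σ ι μ : Type*) where
  send : ID → Finset ID → σ → ID → μ
  compute : ID → Finset ID → σ → ι → (ID → Option μ) → σ

namespace Algorithm

variable {ID σ ι μ : Type*}

/-- One round of the algorithm on the whole network. -/
noncomputable def step (A : Algorithm ID σ ι μ) (N : Network ID) (c : Config σ N)
    (i : N.nodes → ι) : Config σ N :=
  fun p => A.compute p (N.nbrs p) (c p) (i p)
    (N.received p fun u => A.send u (N.nbrs u) (c u) p)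

/-- The configuration after `k` fault-free rounds from `c`, the `j`-th of them with inputs `i j`. -/
noncomputable def run (A : Algorithm ID σ ι μ) (N : Network ID) (c : Config σ N)
    (i : ℕ → N.nodes → ι) : ℕ → Config σ N
  | 0 => c
  | k + 1 => A.step N (A.run N c i k) (i k)

/-- Inputs do not decide legality: if some input sequence keeps the fault-free run from `c` legal
for `k` rounds, then every input sequence leads to a legal configuration after `k` rounds.
This is automatic when there are no inputs (`ι` has one element), and also when every round of
the algorithm preserves legality. -/
def InputsDoNotDecideLegality (A : Algorithm ID σ ι μ) (F : Set (Network ID))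
    (f : LegalityPredicate ID σ) : Prop :=
  ∀ N ∈ F, ∀ (c : Config σ N) (k : ℕ) (i i' : ℕ → N.nodes → ι),
    (∀ j ≤ k, f N (A.run N c i j)) → f N (A.run N c i' k)

end Algorithm

/-- A reactive proof labeling scheme with labels `Λ`: the specification of the initial labelings
for a given initial configuration, the node marker and the node verifier.
`marker p nbrs s i l m` is the new label of `p` at the end of a round, from the state `s` at the
end of the round, the input `i` of the round, the old label `l` and the labels `m`
received from the neighbours at the beginning of the round.
`verifier p nbrs s l m` is the output of `p`, from the state `s` and label `l` at the
beginning of the round and the labels `m` received from the neighbours. -/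
structure RPLS (ID σ ι Λ : Type*) where
  init : (N : Network ID) → Config σ N → (N.nodes → Λ) → Prop
  marker : ID → Finset ID → σ → ι → Λ → (ID → Option Λ) → Λ
  verifier : ID → Finset ID → σ → Λ → (ID → Option Λ) → Bool

/-- An execution of the algorithm together with the scheme. Round `0` is the initial round.
`conf t`, `label t` are the values at the end of round `t`, while
`confStart t`, `labelStart t` are those at the beginning of round `t`, after any faults that occur
just before round `t`. In each round `t + 1`, the algorithm and then the marker are executed. -/
structure Execution {ID σ ι μ Λ : Type*} (A : Algorithm ID σ ι μ) (π : RPLS ID σ ι Λ)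
    (N : Network ID) where
  input : ℕ → N.nodes → ι
  conf : ℕ → Config σ N
  label : ℕ → N.nodes → Λ
  confStart : ℕ → Config σ N
  labelStart : ℕ → N.nodes → Λ
  conf_succ : ∀ t, conf (t + 1) = A.step N (confStart (t + 1)) (input (t + 1))
  label_succ : ∀ t p, label (t + 1) p =
    π.marker p (N.nbrs p) (conf (t + 1) p) (input (t + 1) p) (labelStart (t + 1) p)
      (N.received p (labelStart (t + 1)))

namespace Execution

variable {ID σ ι μ Λ : Type*} {A : Algorithm ID σ ι μ} {π : RPLS ID σ ι Λ} {N : Network ID}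

/-- The output of the verifier at `p` in round `t` (meaningful for `0 < t`). -/
noncomputable def output (e : Execution A π N) (t : ℕ) (p : N.nodes) : Bool :=
  π.verifier p (N.nbrs p) (e.confStart t p) (e.labelStart t p) (N.received p (e.labelStart t))

/-- The environment changes some state or some label just before round `r`
(after the end of the preceding round). -/
def FaultBefore (e : Execution A π N) (r : ℕ) : Prop :=
  ∃ t, r = t + 1 ∧ (e.confStart r ≠ e.conf t ∨ e.labelStart r ≠ e.label t)

/-- The execution is correct until `r` (excluding `r`): no fault occurs before the beginning of
round `r` and every earlier configuration is legal. -/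
def CorrectUntil (e : Execution A π N) (f : LegalityPredicate ID σ) (r : ℕ) : Prop :=
  (∀ k < r, f N (e.conf k)) ∧ ∀ k ≤ r, ¬ e.FaultBefore k

/-- The configuration becomes incorrect in `r`: everything is correct before the faults
that occur just before round `r`, faults occur only there, and the configuration of round `r` is
illegal. For `r = 0` the initial configuration and labels are themselves arbitrary values set by
the environment. -/
def BecomesIncorrect (e : Execution A π N) (f : LegalityPredicate ID σ) (r : ℕ) : Prop :=
  (∀ k < r, f N (e.conf k) ∧ ¬ e.FaultBefore k) ∧ (r = 0 ∨ e.FaultBefore r) ∧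
    (∀ k > r, ¬ e.FaultBefore k) ∧ ¬ f N (e.conf r)

end Execution

/-- Correctness of a reactive proof labeling scheme for `f` and the algorithm `A` on the
family `F`. -/
structure RPLS.Correct {ID σ ι μ Λ : Type*} (π : RPLS ID σ ι Λ) (A : Algorithm ID σ ι μ)
    (F : Set (Network ID)) (f : LegalityPredicate ID σ) : Prop where
  /-- Every legal initial configuration has an initial labeling as specified. -/
  init_exists : ∀ N ∈ F, ∀ c : Config σ N, f N c → ∃ L, π.init N c L
  completeness : ∀ N ∈ F, ∀ (e : Execution A π N) (r : ℕ),
    π.init N (e.conf 0) (e.label 0) → e.CorrectUntil f (r + 1) →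
      ∀ k, 0 < k → k ≤ r + 1 → ∀ p, e.output k p = true
  soundness : ∀ N ∈ F, ∀ (e : Execution A π N) (r : ℕ),
    e.BecomesIncorrect f r → ∃ p, e.output (r + 1) p = false

/-- What a snapshot records about one node at one round: its constants (the identities of its
neighbours), its state at the end of the round, and the input it used in that round, or `none`
if no round was executed (at the start of an execution). -/
structure NodeRecord (ID σ ι : Type*) where
  nbrs : Finset ID
  state : σ
  input : Option ι

/-- A partial snapshot: records of some of the nodes. -/
abbrev Snapshot (ID σ ι : Type*) := ID → Option (NodeRecord ID σ ι)

/-- A pyramid: a list of partial snapshots, the one in position `l` being `l` rounds old. -/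
abbrev Pyramid (ID σ ι : Type*) := List (Snapshot ID σ ι)

/-- The configuration at the end of a round, with the inputs used in that round,
or `none` at the start of an execution. -/
structure Moment {ID : Type*} (σ ι : Type*) (N : Network ID) where
  conf : Config σ N
  input : Option (N.nodes → ι)

/-- The partial snapshot of all nodes within `l` hops from `p` at the moment `m`. -/
noncomputable def snapshotOf {ID σ ι : Type*} (N : Network ID) (m : Moment σ ι N) (p : N.nodes)
    (l : ℕ) : Snapshot ID σ ι :=
  open Classical in
  fun x => if h : ∃ hx : x ∈ N.nodes, N.graph.dist p ⟨x, hx⟩ ≤ l then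
    some ⟨N.nbrs ⟨x, h.1⟩, m.conf ⟨x, h.1⟩, m.input.map fun i => i ⟨x, h.1⟩⟩ else none

/-- The pyramid of `p` for a history in which `past l` is the moment `l` rounds ago: the snapshots
of the nodes within `l` hops, `l` rounds ago, for `l = 0, …, d`, where `d` is the diameter. -/
noncomputable def pyramidOf {ID σ ι : Type*} (N : Network ID) (past : ℕ → Moment σ ι N)
    (p : N.nodes) : Pyramid ID σ ι :=
  (List.range (N.graph.diam + 1)).map fun l => snapshotOf N (past l) p l

/-- `past` describes, backwards in time, a (possibly fictitious) legal execution of the algorithm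
that ends in `c`: all configurations are legal, and a moment is either obtained from the
preceding one by a round of the algorithm with the recorded inputs, or is the start of the
execution, in which case all earlier moments are copies of it. -/
def LegalPast {ID σ ι μ : Type*} (A : Algorithm ID σ ι μ) (f : LegalityPredicate ID σ)
    (N : Network ID) (c : Config σ N) (past : ℕ → Moment σ ι N) : Prop :=
  (past 0).conf = c ∧ ∀ j, f N (past j).conf ∧
    ((∃ i, (past j).input = some i ∧ (past j).conf = A.step N (past (j + 1)).conf i) ∨
      ((past j).input = none ∧ past (j + 1) = past j))

/-- The legal initial labelings of the universal scheme: the pyramids of a legal execution that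
ends in the initial configuration. -/
def LegalInitialPyramids {ID σ ι μ : Type*} (A : Algorithm ID σ ι μ) (f : LegalityPredicate ID σ)
    (N : Network ID) (c : Config σ N) (L : N.nodes → Pyramid ID σ ι) : Prop :=
  ∃ past, LegalPast A f N c past ∧ ∀ p, L p = pyramidOf N past p

/-- The history of an execution as seen at the end of round `t`, continued before the initial
round by `past`: entry `l` is the moment at the end of round `t - l`. -/
def Execution.history {ID σ ι μ Λ : Type*} {A : Algorithm ID σ ι μ} {π : RPLS ID σ ι Λ}
    {N : Network ID} (e : Execution A π N) (past : ℕ → Moment σ ι N) (t : ℕ) :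
    ℕ → Moment σ ι N :=
  fun l => if l < t then ⟨e.conf (t - l), some (e.input (t - l))⟩ else past (l - t)

/-!
The universal scheme labels each node with its pyramid. The marker maintains pyramids, since the
ball of radius `l + 1` around a node is the union of the balls of radius `l` around the node and
its neighbours (`pyramidMarker_pyramidOf`). The verifier at a node accepts if its local view could
arise from the pyramids of some legal execution on some network; completeness is then immediate.

Soundness holds because every configuration accepted by all verifiers is legal, whatever
happened before (`legal_of_pyramidVerifier`). The oldest snapshot of a pyramid covers the whole
network, so each verifier has reconstructed a network from it; neighbours reconstruct the same one
because they see each other's labels, and it is the actual network because each node finds its own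
neighbourhood in it (`exists_legalPast_of_pyramidVerifier`). The legal pasts imagined by the
nodes may differ, but those of `p` and `x` agree on `x` in every position `l` with
`dist p x ≤ l`. Taking each node from its own past therefore gives a history that executes the
algorithm: a node at position `l` depends on its neighbours at position `l + 1`, and there its
own past is right about them. This history starts in the common oldest configuration, from which a
legal run of the same length exists, namely any one of the imagined pasts. Only the inputs may
differ, and inputs do not decide legality.
-/

/-! ### Networks -/

namespace Network

variable {ID : Type*}

theorem mem_nbrs (N : Network ID) (p : N.nodes) (u : ID) :
    u ∈ N.nbrs p ↔ ∃ h : u ∈ N.nodes, N.graph.Adj p ⟨u, h⟩ := by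
  classical
  simp only [nbrs, Finset.mem_filter]
  exact ⟨fun h => h.2, fun h => ⟨h.1, h⟩⟩

theorem received_eq_some {β : Type*} (N : Network ID) (p : N.nodes) (msg : N.nodes → β)
    (u : ID) (b : β) :
    N.received p msg u = some b ↔ ∃ h : u ∈ N.nodes, N.graph.Adj p ⟨u, h⟩ ∧ msg ⟨u, h⟩ = b := by
  unfold received
  split_ifs with h
  · simp only [Option.some.injEq]
    exact ⟨fun hb => ⟨h.1, h.2, hb⟩, fun ⟨_, _, hb⟩ => hb⟩
  · simp only [false_iff]
    exact fun ⟨h1, h2, _⟩ => h ⟨h1, h2⟩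

theorem received_congr {β : Type*} (N : Network ID) (p : N.nodes) {msg msg' : N.nodes → β}
    (h : ∀ u, N.graph.Adj p u → msg u = msg' u) : N.received p msg = N.received p msg' := by
  funext u
  unfold received
  split_ifs with hu
  · rw [h _ hu.2]
  · rfl

/-- A network is determined by its nodes and the neighbourhoods of its nodes. -/
theorem eq_of_nbrs_eq {N N' : Network ID} (hn : N.nodes = N'.nodes)
    (h : ∀ x (hx : x ∈ N.nodes) (hx' : x ∈ N'.nodes), N.nbrs ⟨x, hx⟩ = N'.nbrs ⟨x, hx'⟩) :
    N = N' := by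
  obtain ⟨nodes, graph, conn⟩ := N
  obtain ⟨nodes', graph', conn'⟩ := N'
  dsimp only at hn
  subst hn
  have : graph = graph' := by
    ext ⟨x, hx⟩ ⟨y, hy⟩
    have hxy := h x hx hx
    have := Finset.ext_iff.1 hxy y
    rw [mem_nbrs, mem_nbrs] at this
    exact ⟨fun h => (this.1 ⟨hy, h⟩).2, fun h => (this.2 ⟨hy, h⟩).2⟩
  subst this
  rfl

/-- A connected network that contains all nodes of another one, with the same neighbourhoods,
has no further nodes, since its other nodes would be cut off. -/
theorem eq_of_subset_of_nbrs_eq {N N' : Network ID} (hn : N.nodes ⊆ N'.nodes)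
    (h : ∀ x (hx : x ∈ N.nodes), N'.nbrs ⟨x, hn hx⟩ = N.nbrs ⟨x, hx⟩) : N = N' := by
  refine eq_of_nbrs_eq (hn.antisymm fun y hy => ?_) fun x hx _ => (h x hx).symm
  obtain ⟨p⟩ := N.connected.nonempty
  have key : ∀ {a b : N'.nodes}, N'.graph.Walk a b → a.1 ∈ N.nodes → b.1 ∈ N.nodes := by
    intro a b w
    induction w with
    | nil => exact id
    | @cons u v _ hadj _ ih =>
      intro hu
      have hv : v.1 ∈ N'.nbrs ⟨u.1, hn hu⟩ := (N'.mem_nbrs _ _).2 ⟨v.2, hadj⟩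
      rw [h _ hu, mem_nbrs] at hv
      exact ih hv.1
  obtain ⟨w⟩ := N'.connected.preconnected ⟨p.1, hn p.2⟩ ⟨y, hy⟩
  exact key w p.2

theorem dist_le_diam (N : Network ID) (p q : N.nodes) : N.graph.dist p q ≤ N.graph.diam := by
  have := N.connected.nonempty
  exact SimpleGraph.dist_le_diam (SimpleGraph.connected_iff_ediam_ne_top.1 N.connected)

/-- A relation between nodes that holds for adjacent nodes and is reflexive and transitive holds
for all pairs of nodes. -/
theorem rel_of_adj (N : Network ID) {R : N.nodes → N.nodes → Prop} (hrefl : ∀ p, R p p)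
    (htrans : ∀ p q s, R p q → R q s → R p s) (hadj : ∀ p q, N.graph.Adj p q → R p q)
    (p q : N.nodes) : R p q := by
  obtain ⟨w⟩ := N.connected.preconnected p q
  induction w with
  | nil => exact hrefl _
  | cons h _ ih => exact htrans _ _ _ (hadj _ _ h) ih

/-- The first node of a shortest path is adjacent to its start and one hop closer to its end. -/
theorem exists_adj_dist_le (N : Network ID) {p x : N.nodes} {l : ℕ}
    (h : N.graph.dist p x ≤ l + 1) (hne : p ≠ x) :
    ∃ u, N.graph.Adj p u ∧ N.graph.dist u x ≤ l := by
  obtain ⟨w, hw⟩ := N.connected.exists_walk_length_eq_dist p x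
  cases w with
  | nil => exact absurd rfl hne
  | cons hadj w' =>
    refine ⟨_, hadj, (SimpleGraph.dist_le w').trans ?_⟩
    rw [SimpleGraph.Walk.length_cons] at hw
    omega

theorem dist_le_succ_of_adj (N : Network ID) {p u x : N.nodes} {l : ℕ}
    (hadj : N.graph.Adj p u) (h : N.graph.dist u x ≤ l) : N.graph.dist p x ≤ l + 1 := by
  have h1 := N.connected.dist_triangle (u := p) (v := u) (w := x)
  have h2 := SimpleGraph.dist_eq_one_iff_adj.2 hadj
  omega

end Network

/-! ### Pyramids -/

section Pyramids

variable {ID σ ι μ : Type*}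

/-- The record of the node `x` at the moment `m`. -/
noncomputable def recordOf (N : Network ID) (m : Moment σ ι N) (x : N.nodes) :
    NodeRecord ID σ ι :=
  ⟨N.nbrs x, m.conf x, m.input.map fun i => i x⟩

/-- The record of `x` in the snapshot that is `l` rounds old, if the pyramid contains one. -/
def Pyramid.lookup (P : Pyramid ID σ ι) (l : ℕ) (x : ID) : Option (NodeRecord ID σ ι) :=
  P[l]?.bind fun S => S x

theorem snapshotOf_eq_some (N : Network ID) (m : Moment σ ι N) (p : N.nodes) (l : ℕ) (x : ID)
    (R : NodeRecord ID σ ι) :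
    snapshotOf N m p l x = some R ↔
      ∃ hx : x ∈ N.nodes, N.graph.dist p ⟨x, hx⟩ ≤ l ∧ recordOf N m ⟨x, hx⟩ = R := by
  unfold snapshotOf
  split_ifs with h
  · simp only [Option.some.injEq]
    exact ⟨fun hb => ⟨h.1, h.2, hb⟩, fun ⟨_, _, hb⟩ => hb⟩
  · simp only [false_iff]
    exact fun ⟨h1, h2, _⟩ => h ⟨h1, h2⟩

theorem lookup_pyramidOf_eq_some (N : Network ID) (past : ℕ → Moment σ ι N) (p : N.nodes) (l : ℕ)
    (x : ID) (R : NodeRecord ID σ ι) :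
    Pyramid.lookup (pyramidOf N past p) l x = some R ↔ l ≤ N.graph.diam ∧
      ∃ hx : x ∈ N.nodes, N.graph.dist p ⟨x, hx⟩ ≤ l ∧ recordOf N (past l) ⟨x, hx⟩ = R := by
  rw [← snapshotOf_eq_some]
  unfold Pyramid.lookup pyramidOf
  by_cases hl : l ≤ N.graph.diam
  · rw [List.getElem?_map, List.getElem?_range (by omega)]
    simp [hl]
  · rw [List.getElem?_eq_none (by simp; omega)]
    simp [hl]

theorem length_pyramidOf (N : Network ID) (past : ℕ → Moment σ ι N) (p : N.nodes) :
    (pyramidOf N past p).length = N.graph.diam + 1 := by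
  simp [pyramidOf]

/-- A pyramid determines its network, because its oldest snapshot covers all nodes. -/
theorem network_eq_of_pyramidOf_eq {N N' : Network ID} {past : ℕ → Moment σ ι N}
    {past' : ℕ → Moment σ ι N'} {p : N.nodes} {p' : N'.nodes}
    (h : pyramidOf N past p = pyramidOf N' past' p') : N = N' := by
  have hd : N.graph.diam = N'.graph.diam := by
    have := congrArg List.length h
    rw [length_pyramidOf, length_pyramidOf] at this
    omega
  have h1 : ∀ x (hx : x ∈ N.nodes), ∃ hx' : x ∈ N'.nodes,
      N.nbrs ⟨x, hx⟩ = N'.nbrs ⟨x, hx'⟩ := by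
    intro x hx
    have := (lookup_pyramidOf_eq_some N past p N.graph.diam x _).2
      ⟨le_rfl, hx, N.dist_le_diam _ _, rfl⟩
    rw [h, lookup_pyramidOf_eq_some] at this
    obtain ⟨_, hx', _, hR⟩ := this
    exact ⟨hx', (congrArg NodeRecord.nbrs hR).symm⟩
  have h2 : ∀ x, x ∈ N'.nodes → x ∈ N.nodes := by
    intro x hx
    have := (lookup_pyramidOf_eq_some N' past' p' N'.graph.diam x _).2
      ⟨le_rfl, hx, N'.dist_le_diam _ _, rfl⟩
    rw [← h, lookup_pyramidOf_eq_some] at this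
    exact this.2.1
  exact Network.eq_of_nbrs_eq (Finset.ext fun x => ⟨fun hx => (h1 x hx).1, h2 x⟩)
    fun x hx _ => (h1 x hx).2

theorem recordOf_eq_of_pyramidOf_eq {N : Network ID} {past past' : ℕ → Moment σ ι N}
    {p x : N.nodes} {l : ℕ} (h : pyramidOf N past p = pyramidOf N past' p)
    (hl : l ≤ N.graph.diam) (hx : N.graph.dist p x ≤ l) :
    recordOf N (past l) x = recordOf N (past' l) x := by
  have := (lookup_pyramidOf_eq_some N past p l x.1 _).2 ⟨hl, x.2, hx, rfl⟩
  rw [h, lookup_pyramidOf_eq_some] at this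
  exact this.2.2.2.symm

end Pyramids

/-! ### The marker -/

section Marker

variable {ID σ ι μ : Type*}

open Classical in
/-- The node marker of the pyramid scheme. The newest snapshot holds only the record of the node
itself; the snapshot in position `l + 1` collects the records found in position `l` of the old
labels of the node and of its neighbours. Where these labels disagree about a node, an arbitrary
one of the records is kept. -/
noncomputable def pyramidMarker (p : ID) (B : Finset ID) (s : σ) (i : ι) (P : Pyramid ID σ ι)
    (m : ID → Option (Pyramid ID σ ι)) : Pyramid ID σ ι :=
  (List.range P.length).map fun
    | 0 => fun x => if x = p then some ⟨B, s, some i⟩ else none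
    | l + 1 => fun x =>
      if h : ∃ R, P.lookup l x = some R ∨ ∃ u Q, m u = some Q ∧ Pyramid.lookup Q l x = some R then
        some h.choose else none

/-- The marker turns the pyramids of a history into those of the history extended by one round. The
reason is that the ball of radius `l + 1` around a node is the union of the balls of radius `l`
around the node and its neighbours. -/
theorem pyramidMarker_pyramidOf (N : Network ID) {past past' : ℕ → Moment σ ι N}
    {c : Config σ N} {i : N.nodes → ι} (h0 : past' 0 = ⟨c, some i⟩)
    (hs : ∀ l, past' (l + 1) = past l) (p : N.nodes) :
    pyramidMarker p.1 (N.nbrs p) (c p) (i p) (pyramidOf N past p)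
      (N.received p (pyramidOf N past)) = pyramidOf N past' p := by
  unfold pyramidMarker
  rw [length_pyramidOf]
  conv_rhs => rw [pyramidOf]
  refine List.map_congr_left fun l hl => ?_
  rw [List.mem_range] at hl
  funext x
  refine Option.ext fun R => ?_
  rw [snapshotOf_eq_some]
  cases l with
  | zero =>
    dsimp only
    rw [h0]
    constructor
    · intro h
      split_ifs at h with hx
      subst hx
      refine ⟨p.2, by simp, ?_⟩
      simpa [recordOf] using h
    · rintro ⟨hx, hd, hR⟩
      have hpx : p = ⟨x, hx⟩ := N.connected.dist_eq_zero_iff.1 (Nat.le_zero.1 hd)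
      subst hpx
      simpa [recordOf] using hR
  | succ l =>
    dsimp only
    rw [hs]
    -- The records to be collected are those of the nodes within `l + 1` hops.
    have key : ∀ R, (Pyramid.lookup (pyramidOf N past p) l x = some R ∨
        ∃ u Q, N.received p (pyramidOf N past) u = some Q ∧ Pyramid.lookup Q l x = some R) ↔
        ∃ hx : x ∈ N.nodes, N.graph.dist p ⟨x, hx⟩ ≤ l + 1 ∧
          recordOf N (past l) ⟨x, hx⟩ = R := by
      intro R
      constructor
      · rintro (h | ⟨u, Q, hQ, h⟩)
        · obtain ⟨_, hx, hd, hR⟩ := (lookup_pyramidOf_eq_some ..).1 h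
          exact ⟨hx, by omega, hR⟩
        · obtain ⟨hu, hadj, rfl⟩ := (N.received_eq_some ..).1 hQ
          obtain ⟨_, hx, hd, hR⟩ := (lookup_pyramidOf_eq_some ..).1 h
          exact ⟨hx, N.dist_le_succ_of_adj hadj hd, hR⟩
      · rintro ⟨hx, hd, hR⟩
        by_cases hpx : p = ⟨x, hx⟩
        · left
          refine (lookup_pyramidOf_eq_some ..).2 ⟨by omega, hx, ?_, hR⟩
          rw [← hpx]
          simp
        · right
          obtain ⟨u, hadj, hu⟩ := N.exists_adj_dist_le hd hpx
          exact ⟨u.1, _, (N.received_eq_some ..).2 ⟨u.2, hadj, rfl⟩,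
            (lookup_pyramidOf_eq_some ..).2 ⟨by omega, hx, hu, hR⟩⟩
    rw [← key R]
    constructor
    · intro h
      split_ifs at h with hex
      rw [← Option.some.inj h]
      exact hex.choose_spec
    · intro h
      have hex : ∃ R, Pyramid.lookup (pyramidOf N past p) l x = some R ∨
          ∃ u Q, N.received p (pyramidOf N past) u = some Q ∧ Pyramid.lookup Q l x = some R :=
        ⟨R, h⟩
      rw [dif_pos hex]
      obtain ⟨_, _, h1⟩ := (key _).1 hex.choose_spec
      obtain ⟨_, _, h2⟩ := (key _).1 h
      rw [← h1, ← h2]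

end Marker

/-! ### The verifier -/

section Verifier

variable {ID σ ι μ : Type*}

open Classical in
/-- The node verifier of the pyramid scheme accepts if what it sees is consistent with the pyramids
of some legal execution of the algorithm on some network: its identity, its neighbours, its state,
its label and the labels received are those of a node of that network. -/
noncomputable def pyramidVerifier (A : Algorithm ID σ ι μ) (f : LegalityPredicate ID σ)
    (p : ID) (B : Finset ID) (s : σ) (P : Pyramid ID σ ι) (m : ID → Option (Pyramid ID σ ι)) :
    Bool :=
  decide <| ∃ (N : Network ID) (past : ℕ → Moment σ ι N) (hp : p ∈ N.nodes),
    LegalPast A f N (past 0).conf past ∧ N.nbrs ⟨p, hp⟩ = B ∧ (past 0).conf ⟨p, hp⟩ = s ∧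
      P = pyramidOf N past ⟨p, hp⟩ ∧ m = N.received ⟨p, hp⟩ (pyramidOf N past)

theorem pyramidVerifier_pyramidOf {A : Algorithm ID σ ι μ} {f : LegalityPredicate ID σ}
    {N : Network ID} {c : Config σ N} {past : ℕ → Moment σ ι N} (h : LegalPast A f N c past)
    (p : N.nodes) :
    pyramidVerifier A f p.1 (N.nbrs p) (c p) (pyramidOf N past p)
      (N.received p (pyramidOf N past)) = true := by
  obtain ⟨rfl, h⟩ := h
  classical
  exact decide_eq_true ⟨N, past, p.2, ⟨rfl, h⟩, rfl, rfl, rfl, rfl⟩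

/-- If all verifiers accept, the networks that they reconstruct from the labels are the actual
one, so each node and its neighbours hold the pyramids of a legal past of the actual network.
These pasts may still differ from node to node. -/
theorem exists_legalPast_of_pyramidVerifier {A : Algorithm ID σ ι μ}
    {f : LegalityPredicate ID σ} {N : Network ID} {c : Config σ N} {L : N.nodes → Pyramid ID σ ι}
    (h : ∀ p : N.nodes,
      pyramidVerifier A f p.1 (N.nbrs p) (c p) (L p) (N.received p L) = true) (p : N.nodes) :
    ∃ past : ℕ → Moment σ ι N, LegalPast A f N (past 0).conf past ∧ (past 0).conf p = c p ∧
      L p = pyramidOf N past p ∧ ∀ u, N.graph.Adj p u → L u = pyramidOf N past u := by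
  classical
  have h' := fun p => of_decide_eq_true (h p)
  choose N' past hp hlegal hnbrs hconf hown hrec using h'
  have hnb : ∀ p u, N.graph.Adj p u →
      ∃ hu : u.1 ∈ (N' p).nodes, L u = pyramidOf (N' p) (past p) ⟨u.1, hu⟩ := by
    intro p u hadj
    have := (N.received_eq_some p L u.1 (L u)).2 ⟨u.2, hadj, rfl⟩
    rw [hrec, Network.received_eq_some] at this
    obtain ⟨hu, _, hL⟩ := this
    exact ⟨hu, hL.symm⟩
  have hall : ∀ p q, N' p = N' q :=
    N.rel_of_adj (R := fun p q => N' p = N' q) (fun _ => rfl) (fun _ _ _ => Eq.trans)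
      fun p q hadj => by
        obtain ⟨hu, hL⟩ := hnb p q hadj
        exact network_eq_of_pyramidOf_eq (hL.symm.trans (hown q))
  have hN : N = N' p := by
    have hmem : ∀ q : N.nodes, ∃ hq : q.1 ∈ (N' p).nodes, (N' p).nbrs ⟨q.1, hq⟩ = N.nbrs q := by
      intro q
      rw [hall p q]
      exact ⟨hp q, hnbrs q⟩
    exact Network.eq_of_subset_of_nbrs_eq (fun x hx => (hmem ⟨x, hx⟩).1)
      fun x hx => (hmem ⟨x, hx⟩).2
  -- Only the data at `p` are kept, so that its network can be replaced by `N`.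
  have hnb' := hnb p
  have hlegal' := hlegal p
  have hconf' := hconf p
  have hown' := hown p
  clear hnb hall hlegal hconf hown hrec hnbrs h
  generalize past p = past' at *
  generalize hp p = hp' at *
  generalize N' p = N'' at *
  subst hN
  exact ⟨past', hlegal', hconf', hown', fun u hu => (hnb' u hu).2⟩

end Verifier

/-! ### Legality of an accepted configuration -/

section Legality

variable {ID σ ι μ : Type*}

/-- The moment `m` is obtained from the preceding moment `m'` by a round of the algorithm with the
recorded inputs or, if no inputs are recorded, has the same configuration. -/
def Follows (A : Algorithm ID σ ι μ) (N : Network ID) (m m' : Moment σ ι N) : Prop :=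
  (∃ i, m.input = some i ∧ m.conf = A.step N m'.conf i) ∨ (m.input = none ∧ m.conf = m'.conf)

theorem run_congr (A : Algorithm ID σ ι μ) (N : Network ID) (c : Config σ N)
    {i i' : ℕ → N.nodes → ι} {k : ℕ} (h : ∀ j < k, i j = i' j) :
    A.run N c i k = A.run N c i' k := by
  induction k with
  | zero => rfl
  | succ k ih =>
    rw [Algorithm.run, Algorithm.run, ih fun j hj => h j (by omega), h k (by omega)]

theorem run_update (A : Algorithm ID σ ι μ) (N : Network ID) (c : Config σ N)
    (i : ℕ → N.nodes → ι) (k : ℕ) (v : N.nodes → ι) {j : ℕ} (hj : j ≤ k) :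
    A.run N c (Function.update i k v) j = A.run N c i j :=
  run_congr A N c fun j' hj' => Function.update_of_ne (by omega) ..

/-- Two histories with the same beginning that execute the algorithm in the same rounds are runs
of the same length from the same configuration, possibly with different inputs. -/
theorem exists_run_of_follows [Nonempty ι] {A : Algorithm ID σ ι μ} {f : LegalityPredicate ID σ}
    {N : Network ID} (d : ℕ) (M M' : ℕ → Moment σ ι N) (hM : ∀ l < d, Follows A N (M l) (M (l + 1)))
    (hM' : ∀ l < d, Follows A N (M' l) (M' (l + 1)))
    (hnone : ∀ l < d, (M l).input = none ↔ (M' l).input = none)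
    (hbase : (M d).conf = (M' d).conf) (hlegal : ∀ l ≤ d, f N (M' l).conf) :
    ∃ (k : ℕ) (i i' : ℕ → N.nodes → ι), (M 0).conf = A.run N (M d).conf i k ∧
      (M' 0).conf = A.run N (M d).conf i' k ∧ ∀ j ≤ k, f N (A.run N (M d).conf i' j) := by
  induction d generalizing M M' with
  | zero =>
    obtain ⟨a⟩ := ‹Nonempty ι›
    refine ⟨0, fun _ _ => a, fun _ _ => a, rfl, hbase.symm, fun j hj => ?_⟩
    obtain rfl := Nat.le_zero.1 hj
    have := hlegal 0 le_rfl
    rwa [← hbase] at this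
  | succ d ih =>
    obtain ⟨k, i, i', h1, h2, h3⟩ := ih (fun l => M (l + 1)) (fun l => M' (l + 1))
      (fun l hl => hM _ (by omega)) (fun l hl => hM' _ (by omega))
      (fun l hl => hnone _ (by omega)) hbase (fun l hl => hlegal _ (by omega))
    have hn := hnone 0 (by omega)
    have hl0 := hlegal 0 (by omega)
    rcases hM 0 (by omega) with ⟨v, hv, hc⟩ | ⟨hv, hc⟩ <;>
      rcases hM' 0 (by omega) with ⟨v', hv', hc'⟩ | ⟨hv', hc'⟩
    · refine ⟨k + 1, Function.update i k v, Function.update i' k v', ?_, ?_, fun j hj => ?_⟩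
      · rw [Algorithm.run, run_update _ _ _ _ _ _ le_rfl, Function.update_self, hc, h1]
      · rw [Algorithm.run, run_update _ _ _ _ _ _ le_rfl, Function.update_self, hc', h2]
      · rcases Nat.le_succ_iff.1 hj with hj | rfl
        · rw [run_update _ _ _ _ _ _ hj]
          exact h3 j hj
        · rw [Algorithm.run, run_update _ _ _ _ _ _ le_rfl, Function.update_self]
          rwa [hc', h2] at hl0
    · simp [hv, hv'] at hn
    · simp [hv, hv'] at hn
    · exact ⟨k, i, i', hc.trans h1, hc'.trans h2, h3⟩

theorem LegalPast.follows {A : Algorithm ID σ ι μ} {f : LegalityPredicate ID σ} {N : Network ID}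
    {c : Config σ N} {past : ℕ → Moment σ ι N} (h : LegalPast A f N c past) (l : ℕ) :
    Follows A N (past l) (past (l + 1)) := by
  rcases (h.2 l).2 with h | ⟨h1, h2⟩
  · exact Or.inl h
  · exact Or.inr ⟨h1, by rw [h2]⟩

/-- Soundness of the pyramid scheme: a configuration accepted by all verifiers is legal. The pasts
of the individual nodes are combined into one history, in which each node `x` is as in its own
past. Since the pasts agree wherever neighbouring pyramids overlap, this history executes the
algorithm and begins, as many rounds ago as the diameter, with the configuration in which
all the pasts begin. -/
theorem legal_of_pyramidVerifier [Nonempty ι] {A : Algorithm ID σ ι μ} {F : Set (Network ID)}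
    {f : LegalityPredicate ID σ} (hf : A.InputsDoNotDecideLegality F f) {N : Network ID}
    (hN : N ∈ F) {c : Config σ N} {L : N.nodes → Pyramid ID σ ι}
    (h : ∀ p : N.nodes,
      pyramidVerifier A f p.1 (N.nbrs p) (c p) (L p) (N.received p L) = true) : f N c := by
  choose past hlegal hconf hown hadj using exists_legalPast_of_pyramidVerifier h
  -- Along a shortest path from `p` to `x`, each pyramid covers `x` in position `l`.
  have hrec : ∀ (l : ℕ), l ≤ N.graph.diam → ∀ (n : ℕ), n ≤ l → ∀ p x : N.nodes,
      N.graph.dist p x ≤ n → recordOf N (past p l) x = recordOf N (past x l) x := by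
    intro l hl n
    induction n with
    | zero =>
      intro _ p x hd
      rw [N.connected.dist_eq_zero_iff.1 (Nat.le_zero.1 hd)]
    | succ n ih =>
      intro hn p x hd
      by_cases hpx : p = x
      · rw [hpx]
      · obtain ⟨u, hu, hux⟩ := N.exists_adj_dist_le hd hpx
        rw [← ih (by omega) u x hux]
        exact recordOf_eq_of_pyramidOf_eq ((hown p).symm.trans (hadj u p hu.symm)) hl
          (hd.trans hn)
  have hcf : ∀ l ≤ N.graph.diam, ∀ p x : N.nodes, N.graph.dist p x ≤ l →
      (past p l).conf x = (past x l).conf x :=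
    fun l hl p x hd => congrArg NodeRecord.state (hrec l hl l le_rfl p x hd)
  -- The label of `q` records `q` itself in every position, and for each neighbour `p` of `q` it is
  -- also the pyramid of `q` for the past of `p`.
  have hnone : ∀ l ≤ N.graph.diam, ∀ p q : N.nodes,
      ((past p l).input = none ↔ (past q l).input = none) := by
    intro l hl
    refine N.rel_of_adj (R := fun p q => (past p l).input = none ↔ (past q l).input = none)
      (fun _ => Iff.rfl) (fun _ _ _ => Iff.trans) fun p q hpq => ?_
    have := congrArg NodeRecord.input (recordOf_eq_of_pyramidOf_eq (x := q) (l := l)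
      ((hadj p q hpq).symm.trans (hown q)) hl (by simp))
    have := congrArg (· = none) this
    simpa [recordOf] using this
  obtain ⟨p₀⟩ := N.connected.nonempty
  have a : ι := Classical.arbitrary ι
  -- The combined history; all pasts have inputs in the same rounds, so the default `a` never occurs.
  let M : ℕ → Moment σ ι N := fun l => ⟨fun x => (past x l).conf x,
    (past p₀ l).input.map fun _ x => ((past x l).input.map fun i => i x).getD a⟩
  have hM : ∀ l < N.graph.diam, Follows A N (M l) (M (l + 1)) := by
    intro l hl
    rcases hp : (past p₀ l).input with _ | v
    · refine Or.inr ⟨by simp [M, hp], funext fun x => ?_⟩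
      have hx := (hnone l hl.le p₀ x).1 hp
      rcases (hlegal x).follows l with ⟨i, hi, _⟩ | ⟨_, hc⟩
      · rw [hx] at hi
        cases hi
      · exact congrFun hc x
    · refine Or.inl ⟨_, by simp only [M, hp, Option.map_some]; rfl, funext fun x => ?_⟩
      rcases (hlegal x).follows l with ⟨i, hi, hc⟩ | ⟨hx, _⟩
      · have hc' := congrFun hc x
        rw [show (M l).conf x = (past x l).conf x from rfl, hc']
        simp only [Algorithm.step, hi, Option.map_some, Option.getD_some]
        congr 1
        refine N.received_congr x fun u hu => ?_
        rw [hcf (l + 1) hl x u (by rw [SimpleGraph.dist_eq_one_iff_adj.2 hu]; omega)]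
      · rw [← hnone l hl.le p₀ x, hp] at hx
        cases hx
  obtain ⟨k, i, i', h1, _, h3⟩ := exists_run_of_follows (f := f) N.graph.diam M (past p₀) hM
    (fun l _ => (hlegal p₀).follows l) (fun l _ => by simp [M])
    (funext fun x => (hcf _ le_rfl p₀ x (N.dist_le_diam _ _)).symm) fun l _ => ((hlegal p₀).2 l).1
  have h0 : (M 0).conf = c := funext fun x => hconf x
  rw [← h0, h1]
  exact hf N hN _ k i' i h3

end Legality

/-! ### The universal scheme -/

section Scheme

variable {ID σ ι μ : Type*}

/-- The universal reactive proof labeling scheme, with pyramids as labels. -/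
noncomputable def pyramidScheme (A : Algorithm ID σ ι μ) (f : LegalityPredicate ID σ) :
    RPLS ID σ ι (Pyramid ID σ ι) where
  init := LegalInitialPyramids A f
  marker := pyramidMarker
  verifier := pyramidVerifier A f

namespace Execution

variable {A : Algorithm ID σ ι μ} {N : Network ID}

theorem history_zero {Λ : Type*} {π : RPLS ID σ ι Λ} (e : Execution A π N)
    (past : ℕ → Moment σ ι N) : e.history past 0 = past := by
  funext l
  simp [history]

theorem history_succ_succ {Λ : Type*} {π : RPLS ID σ ι Λ} (e : Execution A π N)
    (past : ℕ → Moment σ ι N) (t l : ℕ) :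
    e.history past (t + 1) (l + 1) = e.history past t l := by
  simp only [history, Nat.add_lt_add_iff_right, Nat.add_sub_add_right]

theorem start_eq_of_not_faultBefore {Λ : Type*} {π : RPLS ID σ ι Λ} {e : Execution A π N} {t : ℕ}
    (h : ¬ e.FaultBefore (t + 1)) :
    e.confStart (t + 1) = e.conf t ∧ e.labelStart (t + 1) = e.label t := by
  by_contra hne
  rw [not_and_or] at hne
  exact h ⟨t, rfl, hne⟩

theorem legalPast_history {Λ : Type*} {π : RPLS ID σ ι Λ} {f : LegalityPredicate ID σ}
    {e : Execution A π N} {past : ℕ → Moment σ ι N} {r : ℕ}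
    (hpast : LegalPast A f N (e.conf 0) past) (he : e.CorrectUntil f (r + 1)) {t : ℕ}
    (ht : t ≤ r) : LegalPast A f N (e.conf t) (e.history past t) := by
  induction t with
  | zero =>
    rw [history_zero]
    exact hpast
  | succ t ih =>
    have ih := ih (by omega)
    refine ⟨by simp [history], fun j => ?_⟩
    cases j with
    | zero =>
      refine ⟨by simpa [history] using he.1 (t + 1) (by omega), Or.inl ⟨e.input (t + 1), ?_, ?_⟩⟩
      · simp [history]
      · rw [history_succ_succ, ih.1, ← (start_eq_of_not_faultBefore (he.2 (t + 1) (by omega))).1,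
          ← e.conf_succ]
        simp [history]
    | succ j =>
      rw [history_succ_succ, history_succ_succ]
      exact ih.2 j

theorem label_eq_pyramidOf_history {f : LegalityPredicate ID σ}
    {e : Execution A (pyramidScheme A f) N} {past : ℕ → Moment σ ι N} {r : ℕ}
    (hlabel : ∀ p, e.label 0 p = pyramidOf N past p) (he : e.CorrectUntil f (r + 1)) {t : ℕ}
    (ht : t ≤ r) : e.label t = pyramidOf N (e.history past t) := by
  induction t with
  | zero =>
    funext p
    rw [hlabel p, history_zero]
  | succ t ih =>
    funext p
    rw [e.label_succ, (start_eq_of_not_faultBefore (he.2 (t + 1) (by omega))).2, ih (by omega)]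
    exact pyramidMarker_pyramidOf N (by simp [history]) (e.history_succ_succ past t) p

end Execution

theorem pyramidScheme_correct {A : Algorithm ID σ ι μ} {F : Set (Network ID)}
    {f : LegalityPredicate ID σ} (hf : A.InputsDoNotDecideLegality F f) :
    (pyramidScheme A f).Correct A F f where
  init_exists N _ c hc :=
    -- The fictitious execution that starts in `c` and has executed no round.
    ⟨_, fun _ => ⟨c, none⟩, ⟨rfl, fun _ => ⟨hc, Or.inr ⟨rfl, rfl⟩⟩⟩, fun _ => rfl⟩
  completeness N _ e r := by
    rintro ⟨past, hpast, hlabel⟩ he k hk hkr p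
    obtain ⟨t, rfl⟩ := Nat.exists_eq_succ_of_ne_zero hk.ne'
    obtain ⟨h1, h2⟩ := Execution.start_eq_of_not_faultBefore (he.2 (t + 1) hkr)
    unfold Execution.output
    rw [Nat.succ_eq_add_one, h1, h2,
      Execution.label_eq_pyramidOf_history hlabel he (t := t) (by omega)]
    exact pyramidVerifier_pyramidOf (Execution.legalPast_history hpast he (by omega)) p
  soundness N hN e r := by
    rintro ⟨_, _, hno, hill⟩
    by_contra hall
    push Not at hall
    obtain ⟨h1, h2⟩ := Execution.start_eq_of_not_faultBefore (hno (r + 1) (Nat.lt_succ_self r))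
    obtain ⟨p₀⟩ := N.connected.nonempty
    have : Nonempty ι := ⟨e.input 0 p₀⟩
    refine hill (legal_of_pyramidVerifier hf hN (L := e.label r) fun p => ?_)
    have := hall p
    unfold Execution.output at this
    rw [h1, h2] at this
    exact Bool.eq_true_of_not_eq_false this

end Scheme

theorem mainTheorem1 {ID σ ι μ : Type*} (A : Algorithm ID σ ι μ) (F : Set (Network ID))
    (f : LegalityPredicate ID σ) (hf : A.InputsDoNotDecideLegality F f) :
    ∃ π : RPLS ID σ ι (Pyramid ID σ ι),
      π.Correct A F f ∧
      (∀ N ∈ F, ∀ (c : Config σ N) (L : N.nodes → Pyramid ID σ ι),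
        π.init N c L ↔ LegalInitialPyramids A f N c L) ∧
      (∀ N ∈ F, ∀ (e : Execution A π N) (past : ℕ → Moment σ ι N) (r : ℕ),
        LegalPast A f N (e.conf 0) past → (∀ p, e.label 0 p = pyramidOf N past p) →
        e.CorrectUntil f (r + 1) →
          ∀ t ≤ r, ∀ p, e.label t p = pyramidOf N (e.history past t) p) :=
  ⟨pyramidScheme A f, pyramidScheme_correct hf, fun _ _ _ _ => Iff.rfl,
    fun _ _ _ _ _ _ hlabel he _ ht p =>
      congrFun (Execution.label_eq_pyramidOf_history hlabel he ht) p⟩
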